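/- Let $1\le n<N$ be integers and $T>0$, and let $X^{(1)},\dots,X^{(n)}$ be independent rate-1 Poisson processes on $[0,\infty)$ (started at $0$, with independent increments, $X^{(i)}_t-X^{(i)}_s$ Poisson distributed with parameter $t-s$ for $s\le t$, and almost surely nondecreasing right-continuous paths). For times $a_i\le b_i$ and sites $y_i,z_i\in\mathbb Z$ let the $i$-th walk be $$L^{(i)}_s=y_i+X^{(i)}_s-X^{(i)}_{a_i},\qquad s\in[a_i,b_i],$$ and let $P[\{(a_i,y_i)\}\to\{(b_i,z_i)\};\text{ no intersection}]$ denote the probability that $L^{(i)}_{b_i}=z_i$ for all $1\le i\le n$ and that, for all $i\ne j$, $L^{(i)}_s\ne L^{(j)}_s$ for every $s\in[a_i,b_i]\cap[a_j,b_j]$. Then these events are measurable (with respect to the completion of $P$) in the three cases below, and the following hold. (1) For every integer $x$ with $1\le x\le N-n+1$ and all $0<t_1<\cdots<t_n<T$, $$P\big[\{(0,1-i)\}\to\{(t_i,x-1)\};\text{ no intersection}\big]=\det\left(e^{-t_j}\frac{t_j^{x+i-2}}{(x+i-2)!}\right)_{i,j=1}^n .$$ (2) For every integer $x$ with $1\le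 x\le N-n+1$ and all $0<t_1<\cdots<t_n<T$, $$P\big[\{(t_i,x)\}\to\{(T,N+1-i)\};\text{ no intersection}\big]=\det\left(e^{-(T-t_j)}\frac{(T-t_j)^{N+1-i-x}}{(N+1-i-x)!}\right)_{i,j=1}^n .$$ (3) $$P\big[\{(0,1-i)\}\to\{(T,N+1-i)\};\text{ no intersection}\big]=\det\left(e^{-T}\frac{T^{N+i-j}}{(N+i-j)!}\right)_{i,j=1}^n .$$ -/

import Mathlib

open MeasureTheory ProbabilityTheory
open scoped NNReal Nat

/-- `X` is a (homogeneous) Poisson process of rate `r` on `(Ω, P)`: a family of `ℕ`-valued random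
variables indexed by time `[0, ∞)`, started at `0`, with independent increments, with
`X t - X s` Poisson distributed of parameter `r (t - s)` for `s ≤ t`, and whose sample paths are
almost surely nondecreasing and right-continuous. -/
structure IsPoissonProcess {Ω : Type*} [MeasurableSpace Ω] (X : ℝ≥0 → Ω → ℕ) (r : ℝ≥0)
    (P : Measure Ω) : Prop where
  measurable : ∀ t, Measurable (X t)
  start_zero : ∀ᵐ ω ∂P, X 0 ω = 0
  indep_increments : HasIndepIncrements (fun t ω => (X t ω : ℤ)) P
  law_increment : ∀ s t : ℝ≥0, s ≤ t →
    HasLaw (fun ω => (X t ω : ℤ) - (X s ω : ℤ))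
      ((poissonMeasure (r * (t - s))).map (fun k : ℕ => (k : ℤ))) P
  path_regular : ∀ᵐ ω ∂P, Monotone (fun t => X t ω) ∧
    ∀ t, ContinuousWithinAt (fun u => X u ω) (Set.Ici t) t

/-- The walk driven by the jumps of `X` that is at the site `y` at time `a`: its position at the
time `s ≥ a`. -/
def walk {Ω : Type*} (X : ℝ≥0 → Ω → ℕ) (a : ℝ≥0) (y : ℤ) (s : ℝ≥0) (ω : Ω) : ℤ :=
  y + ((X s ω : ℤ) - (X a ω : ℤ))

/-- The event `{(a i, y i)} → {(b i, z i)}; no intersection`: the `i`-th walk, which starts from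
the site `y i` at time `a i`, is at the site `z i` at time `b i`, and no two of these paths
(the `i`-th one being run during the time interval `[a i, b i]`) are ever at the same site at the
same time. -/
def nonintersecting {Ω : Type*} {n : ℕ} (X : Fin n → ℝ≥0 → Ω → ℕ)
    (a : Fin n → ℝ≥0) (y : Fin n → ℤ) (b : Fin n → ℝ≥0) (z : Fin n → ℤ) : Set Ω :=
  {ω | (∀ i, walk (X i) (a i) (y i) (b i) ω = z i) ∧
    ∀ i j, i ≠ j → ∀ s ∈ Set.Icc (a i) (b i) ∩ Set.Icc (a j) (b j),
      walk (X i) (a i) (y i) s ω ≠ walk (X j) (a j) (y j) s ω}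

/-!
All three formulas are instances of one Karlin–McGregor formula, `measureReal_nonintersecting`, for
independent Poisson walks from `(a i, y i)` to `(b i, z i)`, with end points such that walks
connecting them in a wrong order have to collide (`CompatibleEndpoints`). The second formula is the
transpose of the matrix given there.

Let `D s c` be the determinant of the matrix of the probabilities to get from the configuration `c`
at time `s` to the end points. Since the walks are independent, and a determinant is linear in each
row, the Chapman–Kolmogorov equation makes `D` a space-time harmonic function
(`integral_det_transitionMatrix`). It vanishes when two walks meet, because two rows agree, and when
a walk ends at a wrong site while the walks are ordered, because a row or a column is zero
(`det_transitionMatrix_of_wrong_end`). A walk that ends at the right site can be split off as a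
block of the matrix, which handles different end times (`IsAdmissible.det_transitionMatrix_cutoff`).
When all walks have ended, the determinant is `1`.

Instead of stopping a martingale at the first collision, the process is observed along a finite grid
of times. If at most one walk jumps between neighbouring times of the grid, and by one site only,
then walks cannot change their order without being seen at the same site at the end of the step. Two
or more jumps in a step of length `h` have probability `O(h ^ 2)`
(`measureReal_compl_singleJumps_le`). Therefore the expectation of `D`, restricted to the event that
the walks are in the right order at all earlier times of the grid, changes by `O(h ^ 2)` in a step,
and the probability of being in the right order on the whole grid differs from `D 0 y` by `O(h)`
(`abs_measureReal_admissibleOnGrid_sub_le`). These events decrease as the grid is refined, and up to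
a null set their intersection is the event of nonintersection (`nonintersecting_ae_eq`): by
right-continuity a collision persists until some time of a fine enough grid, and conversely
nonintersecting walks that are out of order at a time of the grid must have made two jumps in one
step. This also gives measurability with respect to the completion.
-/

/-! ### Poisson weights -/

/-- The Poisson distribution of rate `r`, as a measure on `ℤ`. -/
noncomputable def poissonZ (r : ℝ≥0) : Measure ℤ := (poissonMeasure r).map (fun k : ℕ => (k : ℤ))

instance (r : ℝ≥0) : IsProbabilityMeasure (poissonZ r) :=
  Measure.isProbabilityMeasure_map .of_discrete

/-- The probability that a rate-one Poisson walk moves by exactly `k` sites in time `r`. -/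
noncomputable def poissonWeight (r : ℝ≥0) (k : ℤ) : ℝ := (poissonZ r).real {k}

lemma poissonWeight_natCast (r : ℝ≥0) (k : ℕ) :
    poissonWeight r k = Real.exp (-(r : ℝ)) * (r : ℝ) ^ k / (k ! : ℝ) := by
  rw [poissonWeight, poissonZ, map_measureReal_apply .of_discrete .of_discrete,
    ← poissonMeasure_real_singleton]
  congr 1
  ext m
  simp

lemma poissonWeight_of_neg (r : ℝ≥0) {k : ℤ} (hk : k < 0) : poissonWeight r k = 0 := by
  rw [poissonWeight, poissonZ, map_measureReal_apply .of_discrete .of_discrete]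
  have : (fun k : ℕ => (k : ℤ)) ⁻¹' {k} = ∅ := by
    ext m
    simp
    omega
  simp [this]

lemma poissonWeight_zero_left (k : ℤ) : poissonWeight 0 k = if k = 0 then 1 else 0 := by
  rcases lt_or_ge k 0 with hk | hk
  · rw [poissonWeight_of_neg _ hk, if_neg hk.ne]
  · lift k to ℕ using hk
    rw [poissonWeight_natCast]
    rcases Nat.eq_zero_or_pos k with rfl | h
    · simp
    · simp [h.ne']

lemma poissonWeight_nonneg (r : ℝ≥0) (k : ℤ) : 0 ≤ poissonWeight r k := measureReal_nonneg

lemma poissonWeight_le_one (r : ℝ≥0) (k : ℤ) : poissonWeight r k ≤ 1 := measureReal_le_one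

/-- The Chapman–Kolmogorov equation of the Poisson walk. -/
lemma integral_poissonWeight_sub (r₁ r₂ : ℝ≥0) (k : ℤ) :
    ∫ x, poissonWeight r₂ (k - x) ∂poissonZ r₁ = poissonWeight (r₁ + r₂) k := by
  have h : (poissonZ r₁).conv (poissonZ r₂) = poissonZ (r₁ + r₂) :=
    map_cast_poissonMeasure_conv r₁ r₂
  have h2 : (fun x => poissonWeight r₂ (k - x)) =
      fun x => ((poissonZ r₂) ((fun y => x + y) ⁻¹' {k})).toReal := by
    ext x
    rw [poissonWeight, measureReal_def]
    congr 2
    ext m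
    simp
    omega
  rw [poissonWeight, ← h, measureReal_def, Measure.conv, Measure.map_apply (by fun_prop) (by simp),
    Measure.prod_apply (.of_discrete), h2, integral_toReal .of_discrete (by simp)]
  rfl

/-! ### Admissible configurations and the transition determinant -/

section Deterministic

variable {n : ℕ}

/-- The conditions on the starting points `(a i, y i)` and the end points `(b i, z i)` of walks
which force all walks to be alive at a common time, and which force walks that connect these points
in an order other than the given one to collide. -/
structure CompatibleEndpoints (a : Fin n → ℝ≥0) (y : Fin n → ℤ) (b : Fin n → ℝ≥0)
    (z : Fin n → ℤ) : Prop where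
  mono_start : Monotone a
  mono_end : Monotone b
  anti_start : Antitone y
  anti_end : Antitone z
  start_ne : ∀ i j, i < j → a i < a j ∨ y j < y i
  end_ne : ∀ i j, i < j → b i < b j ∨ z j < z i
  overlap : ∀ i j, a i < b j

/-- The matrix of transition probabilities to the end points `(b j, z j)` from the configuration `c`
at time `u`. A walk that has not started by time `u` waits at `c i` until `a i`. Walks that have
finished by time `v` are decoupled from the rest: their block is the identity. The cutoff `v` is
either `u` or the time of the grid that precedes `u`. -/
noncomputable def transitionMatrix (a b : Fin n → ℝ≥0) (z : Fin n → ℤ) (v u : ℝ≥0)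
    (c : Fin n → ℤ) : Matrix (Fin n) (Fin n) ℝ :=
  Matrix.of fun i j =>
    if b i ≤ v then (if i = j then 1 else 0)
    else if b j ≤ v then 0 else poissonWeight (b j - max u (a i)) (z j - c i)

/-- The configuration `c` is possible at time `s` for nonintersecting walks: no walk is below its
starting point, the walks that have not started are at their starting points, the walks that end at
time `s` are at their end points, and the walks that are alive at time `s` are strictly ordered. -/
def IsAdmissible (a : Fin n → ℝ≥0) (y : Fin n → ℤ) (b : Fin n → ℝ≥0) (z : Fin n → ℤ)
    (s : ℝ≥0) (c : Fin n → ℤ) : Prop :=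
  (∀ i, y i ≤ c i) ∧ (∀ i, s ≤ a i → c i = y i) ∧ (∀ i, s = b i → c i = z i) ∧
    ∀ i j, i < j → a j ≤ s → s ≤ b i → c j < c i

/-- The increments over a time interval ending at `u` in which at most one walk moves, by one site,
and this walk started before `u`. -/
def singleJumps (a : Fin n → ℝ≥0) (u : ℝ≥0) : Set (Fin n → ℤ) :=
  {x | x = 0 ∨ ∃ i, a i < u ∧ x = Pi.single i 1}

variable {a b : Fin n → ℝ≥0} {y z : Fin n → ℤ} {u v : ℝ≥0} {c x : Fin n → ℤ}

lemma abs_det_transitionMatrix_le : |(transitionMatrix a b z v u c).det| ≤ (n ! : ℝ) := by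
  have := Matrix.det_le (A := transitionMatrix a b z v u c) (abv := AbsoluteValue.abs) (x := 1)
    (fun i j => by
      simp only [transitionMatrix, Matrix.of_apply, AbsoluteValue.abs_apply]
      split_ifs
      · simp
      · simp
      · simp
      · rw [abs_of_nonneg (poissonWeight_nonneg _ _)]
        exact poissonWeight_le_one _ _)
  simpa using this

lemma singleJumps_nonneg (hx : x ∈ singleJumps a u) (i : Fin n) : 0 ≤ x i := by
  rcases hx with rfl | ⟨k, -, rfl⟩
  · simp
  · by_cases h : i = k
    · subst h; simp
    · simp [h]

lemma singleJumps_eq_zero (hx : x ∈ singleJumps a u) {i : Fin n} (hi : u ≤ a i) : x i = 0 := by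
  rcases hx with rfl | ⟨k, hk, rfl⟩
  · simp
  · have h : i ≠ k := by rintro rfl; exact absurd hk hi.not_gt
    simp [h]

lemma singleJumps_le (hx : x ∈ singleJumps a u) (i : Fin n) : x i ≤ 1 := by
  rcases hx with rfl | ⟨k, -, rfl⟩
  · simp
  · by_cases h : i = k
    · subst h; simp
    · simp [h]

/-- Strictly ordered walks are still weakly ordered after a single jump. -/
lemma IsAdmissible.le_add_of_singleJumps (h : CompatibleEndpoints a y b z) (huv : v < u)
    (ha : ∀ i, a i ≤ v ∨ u ≤ a i) (hc : IsAdmissible a y b z v c) (hx : x ∈ singleJumps a u)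
    {i j : Fin n} (hij : i < j) (hi : u ≤ b i) : (c + x) j ≤ (c + x) i := by
  obtain ⟨hc1, hc2, -, hc4⟩ := hc
  have hxi := singleJumps_nonneg hx i
  simp only [Pi.add_apply]
  rcases ha j with hj' | hj'
  · have h1 := hc4 i j hij hj' (huv.le.trans hi)
    have h2 := singleJumps_le hx j
    omega
  · have h1 := hc2 j (huv.le.trans hj')
    have h2 := singleJumps_eq_zero hx hj'
    have h3 := hc1 i
    have h4 := h.anti_start hij.le
    omega

/-- For strictly ordered walks one of which finishes at time `u` at the wrong site, the determinant
vanishes: the first such walk yields a zero column if it is too low and a zero row if it is too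
high. -/
lemma det_transitionMatrix_of_wrong_end (h : CompatibleEndpoints a y b z)
    (hvu : v < u) (hb : ∀ i, b i ≤ v ∨ u ≤ b i)
    (hc : ∀ i j, i < j → a j ≤ u → u ≤ b i → c j < c i) (hz : ∃ i, u = b i ∧ c i ≠ z i) :
    (transitionMatrix a b z v u c).det = 0 := by
  classical
  obtain ⟨j₀, ⟨hj, hne⟩, hmin⟩ :=
    (Set.toFinite {i : Fin n | u = b i ∧ c i ≠ z i}).exists_minimal hz
  have hmin' : ∀ i, i < j₀ → u = b i → c i = z i := fun i hi hui => by
    by_contra hcon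
    exact absurd (hmin ⟨hui, hcon⟩ hi.le) hi.not_ge
  have hau : ∀ i, a i ≤ u := fun i => hj ▸ (h.overlap i j₀).le
  have hbj : ¬ b j₀ ≤ v := by rw [← hj]; exact hvu.not_ge
  have hz' : ∀ i, i < j₀ → u = b i → z j₀ < z i := fun i hi hui =>
    (h.end_ne i j₀ hi).resolve_left (by rw [← hui, ← hj]; exact lt_irrefl _)
  rcases hne.lt_or_gt with hlt | hgt
  · refine Matrix.det_eq_zero_of_column_eq_zero j₀ fun i => ?_
    simp only [transitionMatrix, Matrix.of_apply]
    rw [if_neg hbj]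
    split_ifs with h1 h2
    · exact absurd (h2 ▸ h1) hbj
    · rfl
    · have hi : u ≤ b i := (hb i).resolve_left h1
      rw [← hj, max_eq_left (hau i), tsub_self, poissonWeight_zero_left, if_neg]
      rcases lt_trichotomy i j₀ with h3 | h3 | h3
      · have h4 : u = b i := le_antisymm hi (hj ▸ h.mono_end h3.le)
        have := hmin' i h3 h4
        have := hz' i h3 h4
        omega
      · subst h3; omega
      · have := hc j₀ i h3 (hau i) hj.le
        omega
  · refine Matrix.det_eq_zero_of_row_eq_zero j₀ fun j => ?_
    simp only [transitionMatrix, Matrix.of_apply]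
    rw [if_neg hbj]
    split_ifs with h1
    · rfl
    · have hi : u ≤ b j := (hb j).resolve_left h1
      rcases lt_or_ge j j₀ with h3 | h3
      · have h4 : u = b j := le_antisymm hi (hj ▸ h.mono_end h3.le)
        have h5 := hmin' j h3 h4
        have h6 := hc j j₀ h3 (hau j₀) hi
        rw [← h4, max_eq_left (hau j₀), tsub_self, poissonWeight_zero_left, if_neg]
        omega
      · have := h.anti_end h3
        exact poissonWeight_of_neg _ (by omega)

/-- In an admissible configuration the walks that finish at time `u` can be decoupled from the
others without changing the determinant. -/
lemma IsAdmissible.det_transitionMatrix_cutoff (h : CompatibleEndpoints a y b z) (hvu : v < u)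
    (hb : ∀ i, b i ≤ v ∨ u ≤ b i) (hc : IsAdmissible a y b z u c) :
    (transitionMatrix a b z v u c).det = (transitionMatrix a b z u u c).det := by
  classical
  obtain ⟨-, -, hc3, hc4⟩ := hc
  have hau : ∀ j, u = b j → ∀ i, a i ≤ u := fun j hj i => hj ▸ (h.overlap i j).le
  have h1 : ∀ i, ¬ b i ≤ u → ∀ j, b j ≤ u → transitionMatrix a b z v u c i j = 0 := by
    intro i hi j hj
    simp only [transitionMatrix, Matrix.of_apply]
    rw [if_neg fun hh => hi (hh.trans hvu.le)]
    split_ifs with h2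
    · rfl
    · have hj' : u = b j := le_antisymm ((hb j).resolve_left h2) hj
      have hji : j < i := by
        by_contra hcon
        exact hi ((h.mono_end (not_lt.1 hcon)).trans hj)
      have := hc4 j i hji (hau j hj' i) hj'.le
      have := hc3 j hj'
      rw [← hj', max_eq_left (hau j hj' i), tsub_self, poissonWeight_zero_left, if_neg]
      omega
  have h2 : ∀ i, ¬ b i ≤ u → ∀ j, b j ≤ u → transitionMatrix a b z u u c i j = 0 := by
    intro i hi j hj
    simp [transitionMatrix, hi, hj]
  rw [Matrix.twoBlockTriangular_det _ (fun i => b i ≤ u) h1,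
    Matrix.twoBlockTriangular_det _ (fun i => b i ≤ u) h2]
  congr 2
  · ext ⟨i, hi⟩ ⟨j, hj⟩
    simp only [Matrix.toSquareBlockProp_def, transitionMatrix, Matrix.of_apply, hi, hj, if_true]
    split_ifs with h3 h4 h4 h5 h5 <;> try rfl
    · exact absurd (h5 ▸ h4) h3
    · subst h5
      have hj' : u = b i := le_antisymm ((hb i).resolve_left h3) hj
      rw [← hj', max_eq_left (hau i hj' i), tsub_self, poissonWeight_zero_left,
        hc3 i hj', sub_self, if_pos rfl]
    · have hi' : u = b i := le_antisymm ((hb i).resolve_left h3) hi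
      have hj' : u = b j := le_antisymm ((hb j).resolve_left h4) hj
      have := hc3 j hj'
      rw [← hj', max_eq_left (hau i hi' i), tsub_self, poissonWeight_zero_left, if_neg]
      rcases lt_or_gt_of_ne h5 with h6 | h6
      · have := hc4 i j h6 (hau i hi' j) hi'.le
        omega
      · have := hc4 j i h6 (hau i hi' i) hj'.le
        omega
  · ext ⟨i, hi⟩ ⟨j, hj⟩
    have hi' : ¬ b i ≤ v := fun hh => hi (hh.trans hvu.le)
    have hj' : ¬ b j ≤ v := fun hh => hj (hh.trans hvu.le)
    simp [Matrix.toSquareBlockProp_def, transitionMatrix, hi, hj, hi', hj']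

/-- After a single jump from an admissible configuration, the determinant either belongs to an
admissible configuration or vanishes, because two walks have met or a walk has missed its end
point. -/
lemma IsAdmissible.det_transitionMatrix_add (h : CompatibleEndpoints a y b z) (hvu : v < u)
    (ha : ∀ i, a i ≤ v ∨ u ≤ a i) (hb : ∀ i, b i ≤ v ∨ u ≤ b i)
    (hc : IsAdmissible a y b z v c) (hx : x ∈ singleJumps a u) :
    (transitionMatrix a b z v u (c + x)).det =
      {c' | IsAdmissible a y b z u c'}.indicator
        (fun c' => (transitionMatrix a b z u u c').det) (c + x) := by
  classical
  by_cases hadm : IsAdmissible a y b z u (c + x)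
  · rw [Set.indicator_of_mem (by exact hadm)]
    exact hadm.det_transitionMatrix_cutoff h hvu hb
  rw [Set.indicator_of_notMem (by exact hadm)]
  by_cases heq : ∃ i j, i < j ∧ a j ≤ u ∧ u ≤ b i ∧ (c + x) i = (c + x) j
  · obtain ⟨i, j, hij, hj, hi, he⟩ := heq
    refine Matrix.det_zero_of_row_eq hij.ne ?_
    ext k
    have h1 : ¬ b i ≤ v := (hvu.trans_le hi).not_ge
    have h2 : ¬ b j ≤ v := (hvu.trans_le (hi.trans (h.mono_end hij.le))).not_ge
    simp only [transitionMatrix, Matrix.of_apply]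
    rw [if_neg h1, if_neg h2, he, max_eq_left hj, max_eq_left ((h.mono_start hij.le).trans hj)]
  · push Not at heq
    have hstrict : ∀ i j, i < j → a j ≤ u → u ≤ b i → (c + x) j < (c + x) i :=
      fun i j hij hj hi => lt_of_le_of_ne (hc.le_add_of_singleJumps h hvu ha hx hij hi)
        (heq i j hij hj hi).symm
    refine det_transitionMatrix_of_wrong_end h hvu hb hstrict ?_
    by_contra hcon
    push Not at hcon
    refine hadm ⟨fun i => ?_, fun i hi => ?_, hcon, hstrict⟩
    · have h1 := hc.1 i
      have h2 := singleJumps_nonneg hx i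
      simp only [Pi.add_apply]
      omega
    · simp only [Pi.add_apply]
      rw [singleJumps_eq_zero hx hi, hc.2.1 i (hvu.le.trans hi), add_zero]

/-- The law of the increments of the walks between the times `v` and `u`; the walk `i` moves only
after time `a i`. -/
noncomputable def incrementLaw (a : Fin n → ℝ≥0) (v u : ℝ≥0) : Measure (Fin n → ℤ) :=
  Measure.pi fun i => poissonZ (max u (a i) - max v (a i))

instance : IsProbabilityMeasure (incrementLaw a v u) := by
  unfold incrementLaw; infer_instance

lemma integrable_of_abs_le {α : Type*} [MeasurableSpace α] {μ : Measure α} [IsFiniteMeasure μ]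
    {f : α → ℝ} (hf : AEStronglyMeasurable f μ) {B : ℝ} (h : ∀ x, |f x| ≤ B) : Integrable f μ :=
  Integrable.of_bound hf B (.of_forall h)

/-- The determinant is a space-time harmonic function of the configuration. -/
lemma integral_det_transitionMatrix (hvu : v ≤ u) (hb : ∀ i, b i ≤ v ∨ u ≤ b i)
    (h : ∀ i j, a i ≤ b j) (c : Fin n → ℤ) :
    ∫ x, (transitionMatrix a b z v u (c + x)).det ∂incrementLaw a v u =
      (transitionMatrix a b z v v c).det := by
  -- the entries of row `i` as functions of the increment of the `i`-th walk
  let f : Equiv.Perm (Fin n) → Fin n → ℤ → ℝ := fun σ i x =>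
    if b i ≤ v then (if i = σ i then 1 else 0)
    else if b (σ i) ≤ v then 0
    else poissonWeight (b (σ i) - max u (a i)) (z (σ i) - c i - x)
  have h1 : ∀ x, (transitionMatrix a b z v u (c + x)).det =
      ∑ σ : Equiv.Perm (Fin n), ((Equiv.Perm.sign σ : ℤ) : ℝ) * ∏ i, f σ i (x i) := by
    intro x
    rw [← Matrix.det_transpose, Matrix.det_apply']
    refine Finset.sum_congr rfl fun σ _ => ?_
    congr 1
    refine Finset.prod_congr rfl fun i _ => ?_
    simp only [transitionMatrix, Matrix.transpose_apply, Matrix.of_apply, f, Pi.add_apply, sub_sub]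
  have hf : ∀ σ i x, |f σ i x| ≤ 1 := by
    intro σ i x
    simp only [f]
    split_ifs
    · simp
    · simp
    · simp
    · rw [abs_of_nonneg (poissonWeight_nonneg _ _)]
      exact poissonWeight_le_one _ _
  simp_rw [h1]
  rw [integral_finsetSum _ fun σ _ => integrable_of_abs_le (B := 1) .of_discrete fun x => by
    rw [abs_mul, Finset.abs_prod]
    refine mul_le_one₀ ?_ (by positivity) (Finset.prod_le_one (by simp) fun i _ => hf _ _ _)
    rcases Int.units_eq_one_or (Equiv.Perm.sign σ) with hs | hs <;> simp [hs]]
  rw [← Matrix.det_transpose, Matrix.det_apply']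
  refine Finset.sum_congr rfl fun σ _ => ?_
  rw [integral_const_mul, incrementLaw, integral_fintype_prod_eq_prod]
  congr 1
  refine Finset.prod_congr rfl fun i _ => ?_
  simp only [transitionMatrix, Matrix.transpose_apply, Matrix.of_apply, f]
  split_ifs with h2 h3 h3
  · simp
  · simp
  · simp
  · rw [integral_poissonWeight_sub]
    congr 1
    have h4 : max u (a i) ≤ b (σ i) := max_le ((hb _).resolve_left h3) (h _ _)
    rw [add_comm, tsub_add_tsub_cancel h4 (max_le_max_right _ hvu)]

/-- Two jumps in a short time interval are unlikely. -/
lemma measureReal_compl_singleJumps_le (hvu : v ≤ u) (ha : ∀ i, a i ≤ v ∨ u ≤ a i) :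
    (incrementLaw a v u).real (singleJumps a u)ᶜ ≤ (n * ((u : ℝ) - v)) ^ 2 := by
  classical
  set r : Fin n → ℝ≥0 := fun i => max u (a i) - max v (a i) with hr
  set R : ℝ := ∑ i, (r i : ℝ) with hR
  have hr0 : ∀ i, ¬ a i < u → r i = 0 := by
    intro i hi
    have hi := not_lt.1 hi
    simp [hr, max_eq_right hi, max_eq_right (hvu.trans hi)]
  have hrle : ∀ i, (r i : ℝ) ≤ u - v := by
    intro i
    rcases ha i with hi | hi
    · simp [hr, max_eq_left hi, max_eq_left (hi.trans hvu), NNReal.coe_sub hvu]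
    · rw [hr0 i hi.not_gt]
      simpa using hvu
  have hR0 : 0 ≤ R := Finset.sum_nonneg fun i _ => (r i).2
  have hRle : R ≤ n * ((u : ℝ) - v) := by
    calc R ≤ ∑ _i : Fin n, ((u : ℝ) - v) := Finset.sum_le_sum fun i _ => hrle i
      _ = _ := by simp [mul_sub]
  have hsing : ∀ x : Fin n → ℤ,
      (incrementLaw a v u).real {x} = ∏ i, poissonWeight (r i) (x i) := by
    intro x
    rw [measureReal_def, incrementLaw, Measure.pi_singleton, ENNReal.toReal_prod]
    rfl
  have h0 : (incrementLaw a v u).real {0} = Real.exp (-R) := by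
    rw [hsing]
    have : ∀ i, poissonWeight (r i) ((0 : Fin n → ℤ) i) = Real.exp (-(r i : ℝ)) := fun i => by
      simpa using poissonWeight_natCast (r i) 0
    simp_rw [this, ← Real.exp_sum, Finset.sum_neg_distrib]
    rfl
  have h1 : ∀ k, (incrementLaw a v u).real {Pi.single k 1} = r k * Real.exp (-R) := by
    intro k
    rw [hsing]
    have : ∀ i, poissonWeight (r i) ((Pi.single k 1 : Fin n → ℤ) i) =
        (if i = k then (r k : ℝ) else 1) * Real.exp (-(r i : ℝ)) := fun i => by
      by_cases hik : i = k
      · subst hik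
        simpa [mul_comm] using poissonWeight_natCast (r i) 1
      · simpa [hik] using poissonWeight_natCast (r i) 0
    simp_rw [this, Finset.prod_mul_distrib, ← Real.exp_sum, Finset.sum_neg_distrib]
    simp [hR]
  have hset : singleJumps a u = ((insert 0 ((Finset.univ.filter fun i => a i < u).image
      fun i => Pi.single i 1) : Finset (Fin n → ℤ)) : Set (Fin n → ℤ)) := by
    ext x
    simp [singleJumps, eq_comm]
  have hmeas : (incrementLaw a v u).real (singleJumps a u) = Real.exp (-R) * (1 + R) := by
    rw [hset, ← sum_measureReal_singleton, Finset.sum_insert, Finset.sum_image]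
    · rw [h0]
      simp_rw [h1]
      rw [Finset.sum_filter_of_ne, ← Finset.sum_mul]
      · ring
      · intro i _ hne
        by_contra hcon
        simp [hr0 i hcon] at hne
    · intro i _ j _ hij
      by_contra hne
      have := congrFun hij i
      simp [hne] at this
    · simp
  rw [probReal_compl_eq_one_sub .of_discrete, hmeas]
  have h2 : 1 - R ≤ Real.exp (-R) := by
    have := Real.add_one_le_exp (-R)
    linarith
  calc 1 - Real.exp (-R) * (1 + R) ≤ 1 - (1 - R) * (1 + R) := by gcongr
    _ = R ^ 2 := by ring
    _ ≤ _ := by gcongr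

/-- Over a short time step the determinant, killed outside the admissible configurations, is
harmonic up to a quadratic error. -/
lemma IsAdmissible.abs_integral_indicator_sub_le (h : CompatibleEndpoints a y b z) (hvu : v < u)
    (ha : ∀ i, a i ≤ v ∨ u ≤ a i) (hb : ∀ i, b i ≤ v ∨ u ≤ b i)
    (hc : IsAdmissible a y b z v c) :
    |∫ x, {c' | IsAdmissible a y b z u c'}.indicator
        (fun c' => (transitionMatrix a b z u u c').det) (c + x) ∂incrementLaw a v u -
      (transitionMatrix a b z v v c).det| ≤ 2 * n ! * (n * ((u : ℝ) - v)) ^ 2 := by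
  have hbd : ∀ c', |{c' | IsAdmissible a y b z u c'}.indicator
      (fun c' => (transitionMatrix a b z u u c').det) c'| ≤ n ! := fun c' => by
    classical
    rw [Set.indicator_apply]
    split_ifs
    · exact abs_det_transitionMatrix_le
    · simp
  rw [← integral_det_transitionMatrix hvu.le hb (fun i j => (h.overlap i j).le) c,
    ← integral_sub (integrable_of_abs_le .of_discrete fun x => hbd _)
      (integrable_of_abs_le .of_discrete fun x => abs_det_transitionMatrix_le)]
  calc _ ≤ ∫ x, (singleJumps a u)ᶜ.indicator (fun _ => (2 * n ! : ℝ)) x ∂incrementLaw a v u := by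
        refine (abs_integral_le_integral_abs).trans (integral_mono_of_nonneg
          (.of_forall fun _ => abs_nonneg _) (integrable_of_abs_le (B := 2 * n !) .of_discrete
            fun x => ?_) (.of_forall fun x => ?_))
        · classical
          rw [Set.indicator_apply]
          split_ifs
          · rw [abs_of_nonneg (by positivity)]
          · simp
        · by_cases hx : x ∈ singleJumps a u
          · simp only
            rw [Set.indicator_of_notMem (by simpa using hx) (fun _ => (2 * n ! : ℝ)),
              hc.det_transitionMatrix_add h hvu ha hb hx]
            simp
          · simp only
            rw [Set.indicator_of_mem (by simpa using hx) (fun _ => (2 * n ! : ℝ))]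
            refine (abs_sub _ _).trans ?_
            have := hbd (c + x)
            have := abs_det_transitionMatrix_le (a := a) (b := b) (z := z) (v := v) (u := u)
              (c := c + x)
            linarith
    _ = 2 * n ! * (incrementLaw a v u).real (singleJumps a u)ᶜ := by
        rw [integral_indicator_const _ .of_discrete, smul_eq_mul, mul_comm]
    _ ≤ _ := by
        gcongr
        exact measureReal_compl_singleJumps_le hvu.le ha

end Deterministic

/-! ### The walks along a grid of times -/

section Walks

lemma abs_integral_le_of_abs_le {α : Type*} [MeasurableSpace α] {μ : Measure α}
    [IsProbabilityMeasure μ] {f : α → ℝ} {B : ℝ} (h : ∀ x, |f x| ≤ B) : |∫ x, f x ∂μ| ≤ B :=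
  (norm_integral_le_of_norm_le_const (f := f) (μ := μ) (.of_forall h)).trans_eq
    (by rw [probReal_univ, mul_one])

variable {Ω : Type*} {n : ℕ}

/-- The positions at time `s` of the walks that start at the points `(a i, y i)`, each of which
waits at its starting point until it starts. -/
def configuration (X : Fin n → ℝ≥0 → Ω → ℕ) (a : Fin n → ℝ≥0) (y : Fin n → ℤ) (s : ℝ≥0) (ω : Ω) :
    Fin n → ℤ :=
  fun i => walk (X i) (a i) (y i) (max s (a i)) ω

lemma configuration_sub_apply (X : Fin n → ℝ≥0 → Ω → ℕ) (a : Fin n → ℝ≥0) (y : Fin n → ℤ)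
    (v u : ℝ≥0) (ω : Ω) (i : Fin n) :
    (configuration X a y u ω - configuration X a y v ω) i =
      (X i (max u (a i)) ω : ℤ) - X i (max v (a i)) ω := by
  simp [configuration, walk]

lemma isAdmissible_zero {X : Fin n → ℝ≥0 → Ω → ℕ} {a b : Fin n → ℝ≥0} {y z : Fin n → ℤ}
    (h : CompatibleEndpoints a y b z) (ω : Ω) :
    IsAdmissible a y b z 0 (configuration X a y 0 ω) := by
  have h0 : configuration X a y 0 ω = y := by
    ext i
    simp [configuration, walk]
  rw [h0]
  refine ⟨fun i => le_rfl, fun i _ => rfl, fun i hi => ?_, fun i j hij hj _ => ?_⟩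
  · have := h.overlap i i
    simp [← hi] at this
  · refine (h.start_ne i j hij).resolve_left fun hlt => ?_
    exact not_lt_zero (hlt.trans_le hj)

variable [MeasurableSpace Ω] {P : Measure Ω}
  {X : Fin n → ℝ≥0 → Ω → ℕ} {a b : Fin n → ℝ≥0} {y z : Fin n → ℤ}

lemma measurable_configuration (hX : ∀ i, IsPoissonProcess (X i) 1 P) (s : ℝ≥0) :
    Measurable (configuration X a y s) := by
  refine measurable_pi_lambda _ fun i => ?_
  have h1 := (hX i).measurable (max s (a i))
  have h2 := (hX i).measurable (a i)
  simp only [configuration, walk]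
  have hc : Measurable (fun k : ℕ => (k : ℤ)) := .of_discrete
  exact measurable_const.add ((hc.comp h1).sub (hc.comp h2))

/-- The Markov property in the form used below: the increments of the walks after time `s k` are
independent of the configurations at the earlier times of the grid. -/
lemma indepFun_configuration_sub (hX : ∀ i, IsPoissonProcess (X i) 1 P)
    (hindep : iIndepFun (fun i ω t => X i t ω) P) {s : ℕ → ℝ≥0} (hs : Monotone s) (hs0 : s 0 = 0)
    (k : ℕ) :
    IndepFun (fun ω (l : Fin (k + 1)) => configuration X a y (s l) ω)
      (configuration X a y (s (k + 1)) - configuration X a y (s k)) P := by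
  classical
  have hc : Measurable (fun k : ℕ => (k : ℤ)) := .of_discrete
  let η : Fin n → ℕ → Ω → ℤ := fun i l ω =>
    (X i (max (s (l + 1)) (a i)) ω : ℤ) - X i (max (s l) (a i)) ω
  have hη : ∀ i l, Measurable (η i l) := fun i l =>
    (hc.comp ((hX i).measurable _)).sub (hc.comp ((hX i).measurable _))
  have hjoint : iIndepFun (fun (p : Fin n × ℕ) ω => η p.1 p.2 ω) P := by
    refine iIndepFun_uncurry' hη ?_ fun i => ?_
    · exact hindep.comp (fun i (p : ℝ≥0 → ℕ) (l : ℕ) =>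
        (p (max (s (l + 1)) (a i)) : ℤ) - p (max (s l) (a i))) fun i =>
          measurable_pi_lambda _ fun l =>
            (hc.comp (measurable_pi_apply _)).sub (hc.comp (measurable_pi_apply _))
    · exact (hX i).indep_increments.nat (t := fun l => max (s l) (a i))
        fun l m hlm => max_le_max_right _ (hs hlm)
  let S : Finset (Fin n × ℕ) := Finset.univ ×ˢ Finset.range k
  let T : Finset (Fin n × ℕ) := Finset.univ ×ˢ {k}
  have hST : Disjoint S T := by
    rw [Finset.disjoint_left]
    rintro ⟨i, l⟩ h1 h2
    simp [S, T] at h1 h2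
    omega
  have hind := hjoint.indepFun_finset S T hST fun p => hη p.1 p.2
  let past : (S → ℤ) → Fin (k + 1) → Fin n → ℤ := fun w l i =>
    y i + ∑ m ∈ Finset.range l, if h : (i, m) ∈ S then w ⟨(i, m), h⟩ else 0
  let last : (T → ℤ) → Fin n → ℤ := fun w i => w ⟨(i, k), by simp [T]⟩
  have hcomp := hind.comp (Measurable.of_discrete (f := past)) (Measurable.of_discrete (f := last))
  have h1 : (past ∘ fun ω (p : S) => η p.1.1 p.1.2 ω) =
      fun ω (l : Fin (k + 1)) => configuration X a y (s l) ω := by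
    ext ω l i
    have hsum : ∑ m ∈ Finset.range l, η i m ω =
        (X i (max (s l) (a i)) ω : ℤ) - X i (max (s 0) (a i)) ω :=
      Finset.sum_range_sub (fun m => (X i (max (s m) (a i)) ω : ℤ)) l
    have h2 : ∀ m ∈ Finset.range (l : ℕ),
        (if h : (i, m) ∈ S then η i m ω else 0) = η i m ω := fun m hm => by
      have hm' := Finset.mem_range.1 hm
      have hl := l.2
      have : (i, m) ∈ S := by
        simp [S]
        omega
      simp [this]
    simp only [past, Function.comp_apply, configuration, walk]
    rw [Finset.sum_congr rfl h2, hsum, hs0, max_eq_right (zero_le (a := a i))]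
  have h2 : (last ∘ fun ω (p : T) => η p.1.1 p.1.2 ω) =
      configuration X a y (s (k + 1)) - configuration X a y (s k) := by
    ext ω i
    exact (configuration_sub_apply X a y _ _ ω i).symm
  rw [← h1, ← h2]
  exact hcomp

variable [IsProbabilityMeasure P]

lemma map_configuration_sub (hX : ∀ i, IsPoissonProcess (X i) 1 P)
    (hindep : iIndepFun (fun i ω t => X i t ω) P) {v u : ℝ≥0} (hvu : v ≤ u) :
    P.map (configuration X a y u - configuration X a y v) = incrementLaw a v u := by
  have hc : Measurable (fun k : ℕ => (k : ℤ)) := .of_discrete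
  have h1 : iIndepFun (fun i ω => (X i (max u (a i)) ω : ℤ) - X i (max v (a i)) ω) P :=
    hindep.comp (fun i (p : ℝ≥0 → ℕ) => (p (max u (a i)) : ℤ) - p (max v (a i))) fun i =>
      (hc.comp (measurable_pi_apply _)).sub (hc.comp (measurable_pi_apply _))
  have hm : ∀ i, Measurable (fun ω => (X i (max u (a i)) ω : ℤ) - X i (max v (a i)) ω) := fun i =>
    (hc.comp ((hX i).measurable _)).sub (hc.comp ((hX i).measurable _))
  rw [iIndepFun_iff_map_fun_eq_pi_map fun i => (hm i).aemeasurable] at h1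
  have h2 : configuration X a y u - configuration X a y v =
      fun ω i => (X i (max u (a i)) ω : ℤ) - X i (max v (a i)) ω := by
    ext ω i
    exact configuration_sub_apply X a y v u ω i
  rw [h2, h1, incrementLaw]
  congr 1
  ext1 i
  rw [((hX i).law_increment _ _ (max_le_max_right _ hvu)).map_eq, one_mul]
  rfl

/-- Integrating out a variable that is independent of another one. -/
lemma ProbabilityTheory.IndepFun.integral_comp_eq {α β : Type*} [MeasurableSpace α]
    [MeasurableSpace β] [Countable α] [Countable β] [MeasurableSingletonClass α]
    [MeasurableSingletonClass β] {W : Ω → α} {ξ : Ω → β} (h : IndepFun W ξ P) (hW : Measurable W)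
    (hξ : Measurable ξ) {F : α → β → ℝ} {B : ℝ} (hF : ∀ w x, |F w x| ≤ B) :
    ∫ ω, F (W ω) (ξ ω) ∂P = ∫ ω, ∫ x, F (W ω) x ∂P.map ξ ∂P := by
  have h1 := (indepFun_iff_map_prod_eq_prod_map_map hW.aemeasurable hξ.aemeasurable).1 h
  have := Measure.isProbabilityMeasure_map (μ := P) hW.aemeasurable
  have := Measure.isProbabilityMeasure_map (μ := P) hξ.aemeasurable
  calc ∫ ω, F (W ω) (ξ ω) ∂P = ∫ p, F p.1 p.2 ∂(P.map fun ω => (W ω, ξ ω)) :=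
        (integral_map (hW.prodMk hξ).aemeasurable
          (Measurable.of_discrete (f := fun p : α × β => F p.1 p.2)).aestronglyMeasurable).symm
    _ = ∫ w, ∫ x, F w x ∂P.map ξ ∂P.map W := by
        rw [h1]
        exact integral_prod _ (integrable_of_abs_le
          (Measurable.of_discrete (f := fun p : α × β => F p.1 p.2)).aestronglyMeasurable
            fun p => hF p.1 p.2)
    _ = _ := integral_map hW.aemeasurable
          (Measurable.of_discrete (f := fun w => ∫ x, F w x ∂P.map ξ)).aestronglyMeasurable

/-- Along a grid, the determinant at the last time, on the event that all configurations so far are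
admissible, has almost constant expectation. -/
lemma abs_integral_det_sub_le (hX : ∀ i, IsPoissonProcess (X i) 1 P)
    (hindep : iIndepFun (fun i ω t => X i t ω) P) (h : CompatibleEndpoints a y b z)
    {s : ℕ → ℝ≥0} (hs : Monotone s) (hs0 : s 0 = 0) (k : ℕ)
    (hlt : ∀ l < k, s l < s (l + 1))
    (ha : ∀ l < k, ∀ i, a i ≤ s l ∨ s (l + 1) ≤ a i)
    (hb : ∀ l < k, ∀ i, b i ≤ s l ∨ s (l + 1) ≤ b i) :
    |∫ ω, {ω | ∀ l ≤ k, IsAdmissible a y b z (s l) (configuration X a y (s l) ω)}.indicator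
        (fun ω => (transitionMatrix a b z (s k) (s k) (configuration X a y (s k) ω)).det) ω ∂P -
      (transitionMatrix a b z 0 0 y).det| ≤
      ∑ l ∈ Finset.range k, 2 * n ! * (n * ((s (l + 1) : ℝ) - s l)) ^ 2 := by
  classical
  induction k with
  | zero =>
    have h0 : ∀ ω, configuration X a y 0 ω = y := fun ω => by
      ext i
      simp [configuration, walk]
    have h1 := isAdmissible_zero (X := X) h
    simp only [h0] at h1
    have : {ω : Ω | IsAdmissible a y b z 0 y} = Set.univ := Set.eq_univ_of_forall h1
    simp [hs0, h0, this]
  | succ k ih =>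
    have ih := ih (fun l hl => hlt l (by omega)) (fun l hl => ha l (by omega))
      fun l hl => hb l (by omega)
    rw [Finset.sum_range_succ]
    let W : Ω → Fin (k + 1) → Fin n → ℤ := fun ω l => configuration X a y (s l) ω
    let ξ : Ω → Fin n → ℤ := configuration X a y (s (k + 1)) - configuration X a y (s k)
    have hW : Measurable W := measurable_pi_lambda _ fun l => measurable_configuration hX _
    have hξ : Measurable ξ := (measurable_configuration hX _).sub (measurable_configuration hX _)
    let H : Set (Fin (k + 1) → Fin n → ℤ) :=
      {w | ∀ l : Fin (k + 1), IsAdmissible a y b z (s l) (w l)}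
    let G : (Fin n → ℤ) → ℝ := {c' | IsAdmissible a y b z (s (k + 1)) c'}.indicator
        (fun c' => (transitionMatrix a b z (s (k + 1)) (s (k + 1)) c').det)
    let D : (Fin n → ℤ) → ℝ := fun c => (transitionMatrix a b z (s k) (s k) c).det
    have hG : ∀ c, |G c| ≤ n ! := fun c => by
      simp only [G, Set.indicator_apply]
      split_ifs
      · exact abs_det_transitionMatrix_le
      · simp
    have hD : ∀ c, |D c| ≤ n ! := fun c => abs_det_transitionMatrix_le
    let F : (Fin (k + 1) → Fin n → ℤ) → (Fin n → ℤ) → ℝ := fun w x =>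
      if w ∈ H then G (w (Fin.last k) + x) else 0
    have hF : ∀ w x, |F w x| ≤ n ! := fun w x => by
      simp only [F]
      split_ifs
      · exact hG _
      · simp
    have hWH : ∀ ω, W ω ∈ H ↔
        ∀ l ≤ k, IsAdmissible a y b z (s l) (configuration X a y (s l) ω) := fun ω =>
      ⟨fun hh l hl => hh ⟨l, by omega⟩, fun hh l => hh l (by omega)⟩
    have h1 : ∀ ω, {ω | ∀ l ≤ k + 1,
          IsAdmissible a y b z (s l) (configuration X a y (s l) ω)}.indicator
        (fun ω => (transitionMatrix a b z (s (k + 1)) (s (k + 1))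
          (configuration X a y (s (k + 1)) ω)).det) ω = F (W ω) (ξ ω) := by
      intro ω
      have hlast : W ω (Fin.last k) + ξ ω = configuration X a y (s (k + 1)) ω := by
        simp [W, ξ]
      simp only [F, hWH, hlast, G, Set.indicator_apply, Set.mem_ofPred_eq, ← ite_and]
      refine if_congr ⟨fun hh => ⟨fun l hl => hh l (by omega), hh _ le_rfl⟩, fun hh l hl => ?_⟩
        rfl rfl
      rcases Nat.le_succ_iff.1 hl with hl | rfl
      · exact hh.1 l hl
      · exact hh.2
    have h2 : ∀ ω, {ω | ∀ l ≤ k,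
          IsAdmissible a y b z (s l) (configuration X a y (s l) ω)}.indicator
        (fun ω => (transitionMatrix a b z (s k) (s k)
          (configuration X a y (s k) ω)).det) ω =
          if W ω ∈ H then D (W ω (Fin.last k)) else 0 := by
      intro ω
      simp only [hWH, Set.indicator_apply, Set.mem_ofPred_eq]
      rfl
    have hstep : |∫ ω, F (W ω) (ξ ω) ∂P - ∫ ω, (if W ω ∈ H then D (W ω (Fin.last k)) else 0) ∂P| ≤
        2 * n ! * (n * ((s (k + 1) : ℝ) - s k)) ^ 2 := by
      rw [(indepFun_configuration_sub hX hindep hs hs0 k).integral_comp_eq hW hξ hF,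
        map_configuration_sub hX hindep (hs (Nat.le_succ k)), ← integral_sub]
      · refine abs_integral_le_of_abs_le fun ω => ?_
        change |∫ x, F (W ω) x ∂incrementLaw a (s k) (s (k + 1)) -
          (if W ω ∈ H then D (W ω (Fin.last k)) else 0)| ≤ _
        by_cases hw : W ω ∈ H
        · have hFw : ∀ x, F (W ω) x = G (W ω (Fin.last k) + x) := fun x => if_pos hw
          rw [if_pos hw]
          simp_rw [hFw]
          exact IsAdmissible.abs_integral_indicator_sub_le h (hlt k (by omega)) (ha k (by omega))
            (hb k (by omega)) (hw (Fin.last k))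
        · have hFw : ∀ x, F (W ω) x = 0 := fun x => if_neg hw
          rw [if_neg hw]
          simp_rw [hFw, integral_zero, sub_zero, abs_zero]
          positivity
      · refine integrable_of_abs_le (B := n !) ((Measurable.of_discrete
          (f := fun w => ∫ x, F w x ∂incrementLaw a (s k) (s (k + 1)))).comp
            hW).aestronglyMeasurable fun ω => abs_integral_le_of_abs_le (hF (W ω))
      · refine integrable_of_abs_le (B := n !) ((Measurable.of_discrete
          (f := fun w => if w ∈ H then D (w (Fin.last k)) else 0)).comp
            hW).aestronglyMeasurable fun ω => ?_
        split_ifs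
        · exact hD _
        · simp
    simp_rw [h2] at ih
    simp_rw [h1]
    have := abs_sub_le (∫ ω, F (W ω) (ξ ω) ∂P)
      (∫ ω, (if W ω ∈ H then D (W ω (Fin.last k)) else 0) ∂P) (transitionMatrix a b z 0 0 y).det
    linarith

end Walks

/-! ### Finite grids of times -/

section Grid

/-- The sequence `s` enumerates the finite set `G` of times up to `T` in increasing order, until the
index `m`, and its steps are at most `δ`. After the index `m` the sequence stays in `G`. -/
structure IsGridEnumeration (G : Finset ℝ≥0) (T δ : ℝ≥0) (m : ℕ) (s : ℕ → ℝ≥0) : Prop where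
  mono : Monotone s
  zero : s 0 = 0
  last : s m = T
  lt_succ : ∀ l < m, s l < s (l + 1)
  step_le : ∀ l < m, s (l + 1) ≤ s l + δ
  mem : ∀ l, s l ∈ G
  surj : ∀ t ∈ G, ∃ l ≤ m, s l = t
  gap : ∀ l < m, ∀ t ∈ G, t ≤ s l ∨ s (l + 1) ≤ t

lemma exists_isGridEnumeration {G : Finset ℝ≥0} {T δ : ℝ≥0} (h0 : 0 ∈ G) (hT : T ∈ G)
    (hle : ∀ t ∈ G, t ≤ T) (hδ : ∀ t < T, ∃ t' ∈ G, t < t' ∧ t' ≤ t + δ) :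
    ∃ m s, IsGridEnumeration G T δ m s := by
  have hcard : 0 < G.card := Finset.card_pos.2 ⟨0, h0⟩
  obtain ⟨m, hm⟩ : ∃ m, G.card = m + 1 := ⟨G.card - 1, by omega⟩
  let e : Fin (m + 1) ≃o G := G.orderIsoOfFin hm
  let s : ℕ → ℝ≥0 := fun k => e ⟨min k m, by omega⟩
  have hs : Monotone s := fun k l hkl => e.monotone (Fin.mk_le_mk.2 (by omega))
  have hmem : ∀ l, s l ∈ G := fun l => (e _).2
  have hsurj : ∀ t ∈ G, ∃ l ≤ m, s l = t := fun t ht => by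
    refine ⟨e.symm ⟨t, ht⟩, by omega, ?_⟩
    have : (⟨min (e.symm ⟨t, ht⟩ : ℕ) m, by omega⟩ : Fin (m + 1)) = e.symm ⟨t, ht⟩ := by
      ext
      simp
      omega
    simp only [s, this, OrderIso.apply_symm_apply]
  have hlt : ∀ l < m, s l < s (l + 1) := fun l hl =>
    e.strictMono (Fin.mk_lt_mk.2 (by omega))
  have hgap : ∀ l < m, ∀ t ∈ G, t ≤ s l ∨ s (l + 1) ≤ t := fun l _ t ht => by
    obtain ⟨k, -, rfl⟩ := hsurj t ht
    rcases Nat.lt_or_ge l k with h | h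
    · exact .inr (hs h)
    · exact .inl (hs h)
  have hlast : s m = T := by
    obtain ⟨k, hk, hkT⟩ := hsurj T hT
    exact le_antisymm (hle _ (hmem m)) (hkT ▸ hs hk)
  refine ⟨m, s, hs, ?_, hlast, hlt, fun l hl => ?_, hmem, hsurj, hgap⟩
  · obtain ⟨k, -, hk0⟩ := hsurj 0 h0
    exact le_antisymm (hk0 ▸ hs (Nat.zero_le k)) zero_le
  · obtain ⟨t', ht', h1, h2⟩ := hδ (s l) ((hlt l hl).trans_le (hle _ (hmem _)))
    exact ((hgap l hl t' ht').resolve_left h1.not_ge).trans h2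

lemma IsGridEnumeration.sum_sq_le {G : Finset ℝ≥0} {T δ : ℝ≥0} {m : ℕ} {s : ℕ → ℝ≥0}
    (h : IsGridEnumeration G T δ m s) (n : ℕ) :
    ∑ l ∈ Finset.range m, (n * ((s (l + 1) : ℝ) - s l)) ^ 2 ≤ (n : ℝ) ^ 2 * T * δ := by
  calc ∑ l ∈ Finset.range m, (n * ((s (l + 1) : ℝ) - s l)) ^ 2
      ≤ ∑ l ∈ Finset.range m, (n : ℝ) ^ 2 * δ * ((s (l + 1) : ℝ) - s l) := by
        refine Finset.sum_le_sum fun l hl => ?_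
        have h1 : (s l : ℝ) ≤ s (l + 1) := h.mono (Nat.le_succ l)
        have h2 : (s (l + 1) : ℝ) ≤ s l + δ := by
          exact_mod_cast h.step_le l (Finset.mem_range.1 hl)
        rw [mul_pow, pow_two ((s (l + 1) : ℝ) - s l), ← mul_assoc]
        gcongr
        · linarith
    _ = _ := by
        rw [← Finset.mul_sum, Finset.sum_range_sub (fun l => (s l : ℝ)), h.last, h.zero]
        simp
        ring

variable {n : ℕ}

/-- The dyadic times of level `M` in `[0, T]`, together with all starting and end times. -/
noncomputable def timeGrid (a b : Fin n → ℝ≥0) (T : ℝ≥0) (M : ℕ) : Finset ℝ≥0 :=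
  (Finset.range (2 ^ M + 1)).image (fun k : ℕ => (k : ℝ≥0) * (T / 2 ^ M)) ∪
    (Finset.univ.image a ∪ Finset.univ.image b)

variable {a b : Fin n → ℝ≥0} {T : ℝ≥0} {M : ℕ}

lemma mem_timeGrid {t : ℝ≥0} :
    t ∈ timeGrid a b T M ↔
      (∃ k : ℕ, k ≤ 2 ^ M ∧ (k : ℝ≥0) * (T / 2 ^ M) = t) ∨ (∃ i, a i = t) ∨ ∃ i, b i = t := by
  simp [timeGrid]

lemma monotone_timeGrid : Monotone (timeGrid a b T) := by
  refine monotone_nat_of_le_succ fun M t ht => ?_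
  rw [mem_timeGrid] at ht ⊢
  refine ht.imp_left ?_
  rintro ⟨k, hk, rfl⟩
  refine ⟨2 * k, by rw [pow_succ]; omega, ?_⟩
  rw [pow_succ]
  push_cast
  field_simp

lemma le_of_mem_timeGrid (ha : ∀ i, a i ≤ T) (hb : ∀ i, b i ≤ T) {t : ℝ≥0}
    (ht : t ∈ timeGrid a b T M) : t ≤ T := by
  rcases mem_timeGrid.1 ht with ⟨k, hk, rfl⟩ | ⟨i, rfl⟩ | ⟨i, rfl⟩
  · have hk' : (k : ℝ≥0) ≤ 2 ^ M := by exact_mod_cast hk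
    calc (k : ℝ≥0) * (T / 2 ^ M) ≤ 2 ^ M * (T / 2 ^ M) := by gcongr
      _ = T := by field_simp
  · exact ha i
  · exact hb i

lemma exists_mem_timeGrid {t : ℝ≥0} (ht : t < T) :
    ∃ t' ∈ timeGrid a b T M, t < t' ∧ t' ≤ t + T / 2 ^ M := by
  have hT : 0 < T := zero_le.trans_lt ht
  have hd : 0 < T / 2 ^ M := by positivity
  -- the next dyadic time of level `M` after `t`
  have h1 : t / (T / 2 ^ M) < ⌊t / (T / 2 ^ M)⌋₊ + 1 := Nat.lt_floor_add_one _
  have h2 : (⌊t / (T / 2 ^ M)⌋₊ : ℝ≥0) ≤ t / (T / 2 ^ M) := Nat.floor_le zero_le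
  rw [div_lt_iff₀ hd] at h1
  rw [le_div_iff₀ hd] at h2
  refine ⟨(⌊t / (T / 2 ^ M)⌋₊ + 1 : ℕ) * (T / 2 ^ M), mem_timeGrid.2 (.inl ⟨_, ?_, rfl⟩), ?_, ?_⟩
  · have h3 : t / (T / 2 ^ M) < (2 ^ M : ℕ) := by
      rw [div_lt_iff₀ hd]
      push_cast
      rwa [mul_div_cancel₀ _ (by positivity)]
    exact (Nat.floor_lt zero_le).2 h3
  · exact_mod_cast h1
  · push_cast
    rw [add_mul, one_mul]
    gcongr

lemma exists_isGridEnumeration_timeGrid (ha : ∀ i, a i ≤ T) (hb : ∀ i, b i ≤ T) :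
    ∃ m s, IsGridEnumeration (timeGrid a b T M) T (T / 2 ^ M) m s :=
  exists_isGridEnumeration (mem_timeGrid.2 (.inl ⟨0, by simp⟩))
    (mem_timeGrid.2 (.inl ⟨2 ^ M, le_rfl, by push_cast; field_simp⟩))
    (fun _ => le_of_mem_timeGrid ha hb) fun _ => exists_mem_timeGrid

lemma tendsto_const_mul_div_two_pow (C : ℝ) (T : ℝ≥0) :
    Filter.Tendsto (fun M : ℕ => C * (T / 2 ^ M : ℝ≥0)) Filter.atTop (nhds 0) := by
  have := (tendsto_pow_atTop_nhds_zero_of_lt_one (r := (1 / 2 : ℝ)) (by norm_num)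
    (by norm_num)).const_mul (C * T)
  simpa [div_eq_mul_inv, mul_assoc] using this

end Grid

/-! ### Passage to the limit -/

section KarlinMcGregor

variable {Ω : Type*} {n : ℕ} {X : Fin n → ℝ≥0 → Ω → ℕ} {a b : Fin n → ℝ≥0} {y z : Fin n → ℤ}
  {T : ℝ≥0} {M : ℕ}

/-- The event that the walks are in an admissible configuration at all times of the grid of
level `M`. -/
def admissibleOnGrid (X : Fin n → ℝ≥0 → Ω → ℕ) (a : Fin n → ℝ≥0) (y : Fin n → ℤ)
    (b : Fin n → ℝ≥0) (z : Fin n → ℤ) (T : ℝ≥0) (M : ℕ) : Set Ω :=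
  {ω | ∀ t ∈ timeGrid a b T M, IsAdmissible a y b z t (configuration X a y t ω)}

lemma antitone_admissibleOnGrid : Antitone (admissibleOnGrid X a y b z T) :=
  fun _ _ hMN _ hω t ht => hω t (monotone_timeGrid hMN ht)

lemma IsGridEnumeration.admissibleOnGrid_eq {δ : ℝ≥0} {m : ℕ} {s : ℕ → ℝ≥0}
    (hs : IsGridEnumeration (timeGrid a b T M) T δ m s) :
    admissibleOnGrid X a y b z T M =
      {ω | ∀ l ≤ m, IsAdmissible a y b z (s l) (configuration X a y (s l) ω)} := by
  ext ω
  refine ⟨fun hω l _ => hω _ (hs.mem l), fun hω t ht => ?_⟩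
  obtain ⟨l, hl, rfl⟩ := hs.surj t ht
  exact hω l hl

lemma configuration_of_le {s : ℝ≥0} {i : Fin n} (hi : a i ≤ s) (ω : Ω) :
    configuration X a y s ω i = walk (X i) (a i) (y i) s ω := by
  rw [configuration, max_eq_left hi]

/-- If the increments of nonintersecting walks along a grid are single jumps, then the walks keep
their order at all times of the grid. -/
lemma mem_admissibleOnGrid_of_singleJumps (h : CompatibleEndpoints a y b z)
    {δ : ℝ≥0} {m : ℕ} {s : ℕ → ℝ≥0}
    (hs : IsGridEnumeration (timeGrid a b T M) T δ m s) {ω : Ω}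
    (hmono : ∀ i, Monotone fun t => X i t ω) (hω : ω ∈ nonintersecting X a y b z)
    (hj : ∀ l < m, configuration X a y (s (l + 1)) ω - configuration X a y (s l) ω ∈
      singleJumps a (s (l + 1))) :
    ω ∈ admissibleOnGrid X a y b z T M := by
  rw [hs.admissibleOnGrid_eq]
  intro l hl
  induction l with
  | zero => exact hs.zero ▸ isAdmissible_zero h ω
  | succ l ih =>
    have ih := ih (by omega)
    refine ⟨fun i => ?_, fun i hi => ?_, fun i hi => ?_, fun i j hij hj' hi => ?_⟩
    · have := hmono i (le_max_right (s (l + 1)) (a i))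
      simp only at this
      simp only [configuration, walk]
      omega
    · simp [configuration, walk, max_eq_right hi]
    · rw [hi, configuration_of_le (h.overlap i i).le]
      exact hω.1 i
    · have hle := ih.le_add_of_singleJumps h (hs.lt_succ l (by omega))
        (fun i => hs.gap l (by omega) _ (mem_timeGrid.2 (.inr (.inl ⟨i, rfl⟩))))
        (hj l (by omega)) hij hi
      rw [add_sub_cancel] at hle
      refine lt_of_le_of_ne hle fun heq => ?_
      have hi' := (h.mono_start hij.le).trans hj'
      rw [configuration_of_le hi', configuration_of_le hj'] at heq
      exact hω.2 i j hij.ne _ ⟨⟨hi', hi⟩, ⟨hj', hi.trans (h.mono_end hij.le)⟩⟩ heq.symm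

/-- A collision of walks with right-continuous paths is seen at some time of a fine enough grid. -/
lemma mem_nonintersecting_of_forall_mem_admissibleOnGrid (h : CompatibleEndpoints a y b z)
    (hb : ∀ i, b i ≤ T) {ω : Ω}
    (hcont : ∀ i t, ContinuousWithinAt (fun u => X i u ω) (Set.Ici t) t)
    (hω : ∀ M, ω ∈ admissibleOnGrid X a y b z T M) :
    ω ∈ nonintersecting X a y b z := by
  have key : ∀ i j, i < j → ∀ s, a j ≤ s → s ≤ b i →
      walk (X i) (a i) (y i) s ω ≠ walk (X j) (a j) (y j) s ω := by
    intro i j hij s hj hi heq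
    have hai := (h.mono_start hij.le).trans hj
    have hgrid : ∀ M, ∀ t ∈ timeGrid a b T M, a j ≤ t → t ≤ b i →
        walk (X i) (a i) (y i) t ω ≠ walk (X j) (a j) (y j) t ω := by
      intro M t ht hj hi heq
      have := (hω M t ht).2.2.2 i j hij hj hi
      rw [configuration_of_le hj, configuration_of_le ((h.mono_start hij.le).trans hj), heq] at this
      exact lt_irrefl _ this
    rcases hi.eq_or_lt with rfl | hi
    · exact hgrid 0 _ (mem_timeGrid.2 (.inr (.inr ⟨i, rfl⟩))) hj le_rfl heq
    have hconst : ∀ k, ∀ᶠ u in nhdsWithin s (Set.Ici s), X k u ω = X k s ω := fun k =>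
      (hcont k s).eventually (p := fun m => m = X k s ω) (by
        rw [nhds_discrete]
        exact Filter.mem_pure.2 rfl)
    obtain ⟨r, hr, hsub⟩ := mem_nhdsGE_iff_exists_Ico_subset' hi |>.1
      ((hconst i).and (hconst j))
    have hlim : Filter.Tendsto (fun M : ℕ => s + T / 2 ^ M) Filter.atTop (nhds (s + 0)) := by
      refine tendsto_const_nhds.add ?_
      exact NNReal.tendsto_coe.1 (by simpa using tendsto_const_mul_div_two_pow 1 T)
    rw [add_zero] at hlim
    obtain ⟨M, hM⟩ := (hlim.eventually (gt_mem_nhds (lt_min hr hi))).exists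
    obtain ⟨t, ht, hst, htM⟩ := exists_mem_timeGrid (a := a) (b := b) (M := M) (hi.trans_le (hb i))
    have htlt := htM.trans_lt hM
    have heqs := hsub ⟨hst.le, htlt.trans_le (min_le_left _ _)⟩
    refine hgrid M t ht (hj.trans hst.le) (htlt.trans_le (min_le_right _ _)).le ?_
    simp only [walk] at heq ⊢
    rw [heqs.1, heqs.2]
    exact heq
  refine ⟨fun i => ?_, fun i j hij s hs => ?_⟩
  · have := (hω 0 (b i) (mem_timeGrid.2 (.inr (.inr ⟨i, rfl⟩)))).2.2.1 i rfl
    rwa [configuration_of_le (h.overlap i i).le] at this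
  · rcases lt_or_gt_of_ne hij with hij | hij
    · exact key i j hij s hs.2.1 hs.1.2
    · exact (key j i hij s hs.1.1 hs.2.2).symm

variable [MeasurableSpace Ω] {P : Measure Ω}

lemma measurableSet_admissibleOnGrid (hX : ∀ i, IsPoissonProcess (X i) 1 P) :
    MeasurableSet (admissibleOnGrid X a y b z T M) := by
  have : admissibleOnGrid X a y b z T M = ⋂ t ∈ timeGrid a b T M,
      configuration X a y t ⁻¹' {c | IsAdmissible a y b z t c} := by
    ext ω
    simp [admissibleOnGrid]
  rw [this]
  exact Finset.measurableSet_biInter _ fun t _ => measurable_configuration hX t .of_discrete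

variable [IsProbabilityMeasure P]

/-- The probability of being admissible on a grid is the initial determinant, up to an error of the
order of the mesh. -/
lemma abs_measureReal_admissibleOnGrid_sub_le (hX : ∀ i, IsPoissonProcess (X i) 1 P)
    (hindep : iIndepFun (fun i ω t => X i t ω) P) (h : CompatibleEndpoints a y b z)
    (hb : ∀ i, b i ≤ T) :
    |P.real (admissibleOnGrid X a y b z T M) - (transitionMatrix a b z 0 0 y).det| ≤
      2 * n ! * ((n : ℝ) ^ 2 * T * (T / 2 ^ M : ℝ≥0)) := by
  obtain ⟨m, s, hs⟩ := exists_isGridEnumeration_timeGrid (M := M)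
    (fun i => (h.overlap i i).le.trans (hb i)) hb
  have h1 := abs_integral_det_sub_le hX hindep h hs.mono hs.zero m hs.lt_succ
    (fun l hl i => hs.gap l hl _ (mem_timeGrid.2 (.inr (.inl ⟨i, rfl⟩))))
    (fun l hl i => hs.gap l hl _ (mem_timeGrid.2 (.inr (.inr ⟨i, rfl⟩))))
  -- all walks have finished by time `T`, so the matrix is the identity there
  have hone : ∀ c, (transitionMatrix a b z T T c).det = 1 := fun c => by
    have : transitionMatrix a b z T T c = 1 := by
      ext i j
      simp [transitionMatrix, hb, Matrix.one_apply]
    rw [this, Matrix.det_one]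
  rw [← hs.admissibleOnGrid_eq, hs.last] at h1
  simp_rw [hone] at h1
  rw [integral_indicator_const _ (measurableSet_admissibleOnGrid hX), smul_eq_mul, mul_one,
    ← Finset.mul_sum] at h1
  exact h1.trans (by gcongr; exact hs.sum_sq_le n)

/-- Nonintersecting walks fail to be admissible on a grid only if there are two jumps within one of
its steps. -/
lemma measureReal_nonintersecting_diff_le (hX : ∀ i, IsPoissonProcess (X i) 1 P)
    (hindep : iIndepFun (fun i ω t => X i t ω) P) (h : CompatibleEndpoints a y b z)
    (hb : ∀ i, b i ≤ T) :
    P.real (nonintersecting X a y b z \ admissibleOnGrid X a y b z T M) ≤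
      (n : ℝ) ^ 2 * T * (T / 2 ^ M : ℝ≥0) := by
  obtain ⟨m, s, hs⟩ := exists_isGridEnumeration_timeGrid (M := M)
    (fun i => (h.overlap i i).le.trans (hb i)) hb
  let ξ : ℕ → Ω → Fin n → ℤ := fun l =>
    configuration X a y (s (l + 1)) - configuration X a y (s l)
  have hξ : ∀ l, Measurable (ξ l) := fun l =>
    (measurable_configuration hX _).sub (measurable_configuration hX _)
  have hreg : ∀ᵐ ω ∂P, ∀ i, Monotone fun t => X i t ω :=
    ae_all_iff.2 fun i => (hX i).path_regular.mono fun _ hω => hω.1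
  have hsub : (nonintersecting X a y b z \ admissibleOnGrid X a y b z T M : Set Ω) ≤ᵐ[P]
      (⋃ l ∈ Finset.range m, ξ l ⁻¹' (singleJumps a (s (l + 1)))ᶜ : Set Ω) := by
    filter_upwards [hreg] with ω hmono
    rintro ⟨hω, hω'⟩
    by_contra hcon
    refine hω' (mem_admissibleOnGrid_of_singleJumps h hs hmono hω fun l hl => ?_)
    by_contra hl'
    exact hcon (Set.mem_biUnion (Finset.mem_coe.2 (Finset.mem_range.2 hl)) hl')
  calc _ ≤ P.real (⋃ l ∈ Finset.range m, ξ l ⁻¹' (singleJumps a (s (l + 1)))ᶜ) :=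
        ENNReal.toReal_mono (measure_ne_top _ _) (measure_mono_ae hsub)
    _ ≤ ∑ l ∈ Finset.range m, P.real (ξ l ⁻¹' (singleJumps a (s (l + 1)))ᶜ) :=
        measureReal_biUnion_finset_le _ _
    _ ≤ ∑ l ∈ Finset.range m, (n * ((s (l + 1) : ℝ) - s l)) ^ 2 := by
        refine Finset.sum_le_sum fun l hl => ?_
        rw [← map_measureReal_apply (hξ l) .of_discrete,
          map_configuration_sub hX hindep (hs.mono (Nat.le_succ l))]
        exact measureReal_compl_singleJumps_le (hs.mono (Nat.le_succ l)) fun i =>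
          hs.gap l (Finset.mem_range.1 hl) _ (mem_timeGrid.2 (.inr (.inl ⟨i, rfl⟩)))
    _ ≤ _ := hs.sum_sq_le n

/-- Up to a null set, nonintersection is the same as admissibility at all times of all grids. -/
lemma nonintersecting_ae_eq (hX : ∀ i, IsPoissonProcess (X i) 1 P)
    (hindep : iIndepFun (fun i ω t => X i t ω) P) (h : CompatibleEndpoints a y b z)
    (hb : ∀ i, b i ≤ T) :
    nonintersecting X a y b z =ᵐ[P] ⋂ M, admissibleOnGrid X a y b z T M := by
  have hreg : ∀ᵐ ω ∂P, ∀ i t, ContinuousWithinAt (fun u => X i u ω) (Set.Ici t) t :=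
    ae_all_iff.2 fun i => (hX i).path_regular.mono fun _ hω => hω.2
  have h1 : ∀ M, P (nonintersecting X a y b z \ admissibleOnGrid X a y b z T M) = 0 := by
    intro M
    rw [← measureReal_eq_zero_iff]
    refine le_antisymm (ge_of_tendsto (tendsto_const_mul_div_two_pow ((n : ℝ) ^ 2 * T) T) ?_)
      measureReal_nonneg
    filter_upwards [Filter.eventually_ge_atTop M] with M' hM'
    exact (measureReal_mono (Set.sdiff_subset_sdiff_right (antitone_admissibleOnGrid hM'))).trans
      (measureReal_nonintersecting_diff_le hX hindep h hb)
  refine Filter.EventuallyLE.antisymm ?_ ?_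
  · refine ae_le_set.2 ?_
    rw [Set.sdiff_iInter]
    exact measure_iUnion_null h1
  · filter_upwards [hreg] with ω hcont hω
    exact mem_nonintersecting_of_forall_mem_admissibleOnGrid h hb hcont (Set.mem_iInter.1 hω)

/-- The Karlin–McGregor formula for Poisson walks with staggered starting and end times. -/
theorem measureReal_nonintersecting (hX : ∀ i, IsPoissonProcess (X i) 1 P)
    (hindep : iIndepFun (fun i ω t => X i t ω) P) (h : CompatibleEndpoints a y b z) :
    NullMeasurableSet (nonintersecting X a y b z) P ∧
      P.real (nonintersecting X a y b z) =
        (Matrix.of fun i j => poissonWeight (b j - a i) (z j - y i)).det := by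
  obtain ⟨T, hb⟩ : ∃ T, ∀ i, b i ≤ T :=
    ⟨Finset.univ.sup b, fun i => Finset.le_sup (Finset.mem_univ i)⟩
  have hae := nonintersecting_ae_eq hX hindep h hb
  have hmeas : ∀ M, MeasurableSet (admissibleOnGrid X a y b z T M) := fun M =>
    measurableSet_admissibleOnGrid hX
  refine ⟨(MeasurableSet.iInter hmeas).nullMeasurableSet.congr hae.symm, ?_⟩
  have hmat : transitionMatrix a b z 0 0 y =
      Matrix.of fun i j => poissonWeight (b j - a i) (z j - y i) := by
    have hpos : ∀ i, b i ≠ 0 := fun i => (zero_le.trans_lt (h.overlap i i)).ne'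
    ext i j
    simp [transitionMatrix, hpos]
  rw [measureReal_congr hae, ← hmat]
  refine tendsto_nhds_unique ((ENNReal.tendsto_toReal (measure_ne_top _ _)).comp
    (tendsto_measure_iInter_atTop (fun M => (hmeas M).nullMeasurableSet)
      antitone_admissibleOnGrid ⟨0, measure_ne_top _ _⟩)) ?_
  refine tendsto_iff_norm_sub_tendsto_zero.2 (squeeze_zero (fun _ => norm_nonneg _)
    (fun M => abs_measureReal_admissibleOnGrid_sub_le hX hindep h hb) ?_)
  simp_rw [← mul_assoc]
  exact tendsto_const_mul_div_two_pow _ T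

end KarlinMcGregor

/-! ### The three determinantal formulas -/

/-- Karlin–McGregor formulas for independent rate-1 Poisson walks. The index `i : Fin n` is
zero-based: it stands for the walker with the label `(i : ℕ) + 1`. -/
theorem mainTheorem3 {Ω : Type*} [MeasurableSpace Ω] (P : Measure Ω) [IsProbabilityMeasure P]
    (n N : ℕ) (hN : n < N) (T : ℝ≥0) (hT : 0 < T)
    (X : Fin n → ℝ≥0 → Ω → ℕ) (hX : ∀ i, IsPoissonProcess (X i) 1 P)
    (hindep : iIndepFun (fun i ω t => X i t ω) P) :
    (∀ (x : ℕ) (t : Fin n → ℝ≥0), 1 ≤ x → x + n ≤ N + 1 →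
      StrictMono t → (∀ i, 0 < t i ∧ t i < T) →
        (NullMeasurableSet (nonintersecting X (fun _ => 0) (fun i => 1 - ((i : ℤ) + 1))
            t (fun _ => (x : ℤ) - 1)) P ∧
          P.real (nonintersecting X (fun _ => 0) (fun i => 1 - ((i : ℤ) + 1))
            t (fun _ => (x : ℤ) - 1)) =
          Matrix.det (Matrix.of fun i j : Fin n =>
            Real.exp (-(t j : ℝ)) * (t j : ℝ) ^ (x + ((i : ℕ) + 1) - 2) /
              ((x + ((i : ℕ) + 1) - 2)! : ℝ))) ∧
        (NullMeasurableSet (nonintersecting X t (fun _ => (x : ℤ))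
            (fun _ => T) (fun i => (N : ℤ) + (1 - ((i : ℤ) + 1)))) P ∧
          P.real (nonintersecting X t (fun _ => (x : ℤ))
            (fun _ => T) (fun i => (N : ℤ) + (1 - ((i : ℤ) + 1)))) =
          Matrix.det (Matrix.of fun i j : Fin n =>
            Real.exp (-((T : ℝ) - (t j : ℝ))) *
              ((T : ℝ) - (t j : ℝ)) ^ (N + 1 - ((i : ℕ) + 1) - x) /
              ((N + 1 - ((i : ℕ) + 1) - x)! : ℝ)))) ∧
    (NullMeasurableSet (nonintersecting X (fun _ => 0) (fun i => 1 - ((i : ℤ) + 1))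
        (fun _ => T) (fun i => (N : ℤ) + (1 - ((i : ℤ) + 1)))) P ∧
      P.real (nonintersecting X (fun _ => 0) (fun i => 1 - ((i : ℤ) + 1))
        (fun _ => T) (fun i => (N : ℤ) + (1 - ((i : ℤ) + 1)))) =
      Matrix.det (Matrix.of fun i j : Fin n =>
        Real.exp (-(T : ℝ)) * (T : ℝ) ^ (N + ((i : ℕ) + 1) - ((j : ℕ) + 1)) /
          ((N + ((i : ℕ) + 1) - ((j : ℕ) + 1))! : ℝ))) := by 
  have hshift : ∀ i : Fin n, ∀ j, i < j → (1 : ℤ) - ((j : ℤ) + 1) < 1 - ((i : ℤ) + 1) :=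
    fun i j hij => by
      have : (i : ℕ) < j := hij
      omega
  have hanti : Antitone fun i : Fin n => (1 : ℤ) - ((i : ℤ) + 1) :=
    StrictAnti.antitone fun i j hij => hshift i j hij
  refine ⟨fun x t hx hxn ht htT => ⟨?_, ?_⟩, ?_⟩
  · obtain ⟨h1, h2⟩ := measureReal_nonintersecting hX hindep (a := fun _ => 0)
      (y := fun i => 1 - ((i : ℤ) + 1)) (b := t) (z := fun _ => (x : ℤ) - 1)
      ⟨monotone_const, ht.monotone, hanti, antitone_const, fun i j hij => .inr (hshift i j hij),
        fun i j hij => .inl (ht hij), fun _ j => (htT j).1⟩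
    refine ⟨h1, h2.trans ?_⟩
    congr 2
    ext i j
    have he : (x : ℤ) - 1 - (1 - ((i : ℤ) + 1)) = ((x + ((i : ℕ) + 1) - 2 : ℕ) : ℤ) := by omega
    rw [he, poissonWeight_natCast, tsub_zero]
  · obtain ⟨h1, h2⟩ := measureReal_nonintersecting hX hindep (a := t)
      (y := fun _ => (x : ℤ)) (b := fun _ => T) (z := fun i => (N : ℤ) + (1 - ((i : ℤ) + 1)))
      ⟨ht.monotone, monotone_const, antitone_const, fun i j hij => by
          have := hanti hij
          simp only at this ⊢
          omega,
        fun i j hij => .inl (ht hij), fun i j hij => .inr (by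
          have := hshift i j hij
          omega), fun i _ => (htT i).2⟩
    refine ⟨h1, h2.trans ?_⟩
    rw [← Matrix.det_transpose]
    congr 1
    ext i j
    have he : (N : ℤ) + (1 - ((i : ℤ) + 1)) - x = ((N + 1 - ((i : ℕ) + 1) - x : ℕ) : ℤ) := by
      have := i.2
      omega
    simp only [Matrix.transpose_apply, Matrix.of_apply]
    rw [he, poissonWeight_natCast, NNReal.coe_sub (htT j).2.le]
  · obtain ⟨h1, h2⟩ := measureReal_nonintersecting hX hindep (a := fun _ => 0)
      (y := fun i => 1 - ((i : ℤ) + 1)) (b := fun _ => T)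
      (z := fun i => (N : ℤ) + (1 - ((i : ℤ) + 1)))
      ⟨monotone_const, monotone_const, hanti, fun i j hij => by
          have := hanti hij
          simp only at this ⊢
          omega,
        fun i j hij => .inr (hshift i j hij), fun i j hij => .inr (by
          have := hshift i j hij
          omega), fun _ _ => hT⟩
    refine ⟨h1, h2.trans ?_⟩
    congr 2
    ext i j
    have he : (N : ℤ) + (1 - ((j : ℤ) + 1)) - (1 - ((i : ℤ) + 1)) =
        ((N + ((i : ℕ) + 1) - ((j : ℕ) + 1) : ℕ) : ℤ) := by
      have := j.2
      omega
    rw [he, poissonWeight_natCast, tsub_zero]
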